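/- Let $S^1=\mathbb R/\mathbb Z$ with its quotient metric $d$, and let $\psi:S^1\to\mathbb R$ be a $C^2$ function whose critical set $C=\{x\in S^1:\psi'(x)=0\}$ is finite and such that $\psi''(x)\ne 0$ for every $x\in C$. For $L>0$ and $a\in[0,1)$ let $f=f_{L,a}:S^1\to S^1$, $f(x)=L\psi(x)+a \pmod 1$. For $c>0$ and $k\in\mathbb N$, condition $(H3)_{c,k}$ says that $d(f^l(\hat x),C)\ge c$ for all $\hat x\in C$ and all $1\le l\le k$. For $\epsilon>0$ let $\omega_0,\omega_1,\dots$ be independent and uniformly distributed on $[-\epsilon,\epsilon]$, put $f_\omega(x)=f(x+\omega)$, and consider the random compositions $f^n_{\underline\omega}=f_{\omega_{n-1}}\circ\cdots\circ f_{\omega_0}$, that is, the Markov chain $X_{n+1}=f_{\omega_n}(X_n)$ with transition probabilities $P(x,B)=\mathbb P(f_{\omega_0}(x)\in B)$. A Borel probability measure $\mu$ on $S^1$ is stationary if $\mu(B)=\int_{S^1}P(x,B)\,d\mu(x)$ for every Borel set $B\subset S^1$; a stationary $\mu$ is ergodic if $\mu(A)\in\{0,1\}$ for every Borel set $A$ with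 $P(x,A)=\mathbf 1_A(x)$ for $\mu$-almost every $x$. Theorem. For all $\beta,c\in(0,1)$ there is $L_0=L_0(\psi,\beta,c)>0$ such that the following holds for all $L\ge L_0$, all $a\in[0,1)$ and all $k\in\mathbb N$: if $f=f_{L,a}$ satisfies $(H3)_{c,k}$ and $\epsilon\ge L^{-(2k+1)(1-\beta)}$, then there is exactly one stationary probability measure $\mu$ of the random composition $f^n_{\underline\omega}$; this measure is ergodic, and its support is all of $S^1$. -/

import Mathlib

open MeasureTheory ProbabilityTheory

/-- The derivative of a real function on the circle `S¹ = ℝ/ℤ`, in the coordinate of `ℝ`. -/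
noncomputable def circleDeriv (ψ : UnitAddCircle → ℝ) (x : UnitAddCircle) : ℝ :=
  deriv (fun t : ℝ => ψ (x + (t : UnitAddCircle))) 0

/-- `ψ : S¹ → ℝ` is of class `C²`: its 1-periodic lift to `ℝ` is. -/
def IsC2OnCircle (ψ : UnitAddCircle → ℝ) : Prop :=
  ContDiff ℝ 2 (fun t : ℝ => ψ (t : UnitAddCircle))

/-- The critical set `{x ∈ S¹ : ψ'(x) = 0}`. -/
def critSet (ψ : UnitAddCircle → ℝ) : Set UnitAddCircle :=
  {x | circleDeriv ψ x = 0}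

/-- The standing assumptions on `ψ`: it is `C²`, it has finitely many critical points, and all of
them are nondegenerate. -/
structure IsAdmissible (ψ : UnitAddCircle → ℝ) : Prop where
  isC2 : IsC2OnCircle ψ
  finite_critSet : (critSet ψ).Finite
  nondegenerate : {x | circleDeriv (circleDeriv ψ) x = 0} ∩ critSet ψ = ∅

/-- The circle map `f = L ψ + a (mod 1)`. -/
noncomputable def familyMap (ψ : UnitAddCircle → ℝ) (L a : ℝ) (x : UnitAddCircle) :
    UnitAddCircle :=
  ((L * ψ x + a : ℝ) : UnitAddCircle)

/-- The finite-time condition: `d(f^l x̂, C) ≥ c` for every critical point `x̂` and `1 ≤ l ≤ k`,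
where `C` is the critical set of `ψ`. -/
def PostcriticalSeparation (ψ : UnitAddCircle → ℝ) (L a c : ℝ) (k : ℕ) : Prop :=
  ∀ x ∈ critSet ψ, ∀ l : ℕ, 1 ≤ l → l ≤ k →
    c ≤ Metric.infDist ((familyMap ψ L a)^[l] x) (critSet ψ)

/-- The uniform distribution on `[-ε, ε]`. -/
noncomputable def uniformNoise (ε : ℝ) : Measure ℝ :=
  cond (volume : Measure ℝ) (Set.Icc (-ε) ε)

/-- The perturbed map `f_ω(x) = f(x + ω)`. -/
def perturbedMap (f : UnitAddCircle → UnitAddCircle) (ω : ℝ) (x : UnitAddCircle) :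
    UnitAddCircle :=
  f (x + (ω : UnitAddCircle))

/-- The transition probabilities `P(x, B)` of the Markov chain `X_{n+1} = f_{ω_n}(X_n)`, where
the `ω_n` are independent and uniformly distributed on `[-ε, ε]`. -/
noncomputable def transitionProb (f : UnitAddCircle → UnitAddCircle) (ε : ℝ)
    (x : UnitAddCircle) (B : Set UnitAddCircle) : ENNReal :=
  uniformNoise ε {ω : ℝ | perturbedMap f ω x ∈ B}

/-- A stationary (probability) measure: `μ(B) = ∫ P(x, B) dμ(x)` for every Borel set `B`. -/
structure IsStationaryMeasure (f : UnitAddCircle → UnitAddCircle) (ε : ℝ)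
    (μ : Measure UnitAddCircle) : Prop where
  isProbabilityMeasure : IsProbabilityMeasure μ
  stationary : ∀ B : Set UnitAddCircle, MeasurableSet B →
    μ B = ∫⁻ x, transitionProb f ε x B ∂μ

/-- Ergodicity of a stationary measure `μ`: a Borel set that is invariant for the chain modulo
`μ`, i.e. `P(x, A) = 1_A(x)` for `μ`-almost every `x`, has measure `0` or `1`. -/
def IsErgodicStationary (f : UnitAddCircle → UnitAddCircle) (ε : ℝ)
    (μ : Measure UnitAddCircle) : Prop :=
  IsStationaryMeasure f ε μ ∧
    ∀ A : Set UnitAddCircle, MeasurableSet A →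
      (∀ᵐ x ∂μ, transitionProb f ε x A = A.indicator (fun _ => (1 : ENNReal)) x) →
      μ A = 0 ∨ μ A = 1

/-!
The random map has two features: it smooths, and it is topologically irreducible. They are combined
as follows.

*Smoothing.* The law of `x + ω` is uniform on an arc, so `x ↦ P(x, B)` is continuous for every
Borel set `B` (`continuous_transitionProb`). Suppose that the only nonempty closed set sent into
itself by all `f_ω`, `|ω| < ε`, is the circle (`NoiseMinimal`). The support of a stationary measure
is such a set, hence is everything, and by continuity a statement on `P(x, A)` that holds almost
surely holds for all `x`. If `P(x, A) = 1_A(x)` almost surely, then `P(·, A)` is a continuous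
function with values in `{0, 1}`, hence constant; this is ergodicity. For uniqueness, the positive
and negative parts of the difference of two stationary measures are again stationary, live on
complementary sets, and both have full support, which is impossible. Existence is the
Krylov–Bogoliubov argument.

*Irreducibility.* Lift to the line, with `F = L Ψ + a`. A noise-invariant set contains an interval
of length `ε`; it suffices to make its length grow to a constant `c₁`, since then the next image
has length at least one (`CriticalBounds.exists_long_image`). Take a quarter of an interval of
length `ℓ` at distance about `d ≥ ℓ / 4` from the critical set. Its image has length of order
`L d ℓ` and is at distance of order `L d ^ 2` from a critical value `F z`. While the images follow
the orbit of `F z`, which stays away from the critical set for `k` steps, they are expanded by a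
factor of order `L` each time. If they cease to follow it at a time `m < k`, then `L ^ (m + 1) d ^ 2`
is bounded below, and the total factor `L ^ (m + 1) d` is large. If they follow it for all `k`
steps, the factor is `L ^ (k + 1) d`; it can be small only if `d` is so small that
`L d ^ 2` is much less than `L ^ (-(2 k + 1) (1 - β)) ≤ ε`. In that case the noise produces an
interval of length `ε / 2` ending at `F z`, and `k` steps along the critical orbit give it length
of order `ε L ^ k`. From then on `d` is at least of order `ε L ^ k`, and the factor
`L ^ (k + 1) d ≥ ε L ^ (2 k + 1) ≥ L ^ ((2 k + 1) β)`, up to constants, is always large: the length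
doubles until it reaches `c₁`.
-/

/-! ### The transition probabilities -/

lemma isProbabilityMeasure_uniformNoise {ε : ℝ} (hε : 0 < ε) :
    IsProbabilityMeasure (uniformNoise ε) := by
  apply cond_isProbabilityMeasure_of_finite
  · rw [Real.volume_Icc]
    simpa using hε
  · simp

lemma continuous_perturbedMap {f : UnitAddCircle → UnitAddCircle} (hf : Continuous f)
    (x : UnitAddCircle) : Continuous fun ω : ℝ => perturbedMap f ω x :=
  hf.comp (continuous_const.add (AddCircle.continuous_mk' 1))

lemma continuous_perturbedMap_uncurry {f : UnitAddCircle → UnitAddCircle} (hf : Continuous f) :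
    Continuous fun p : UnitAddCircle × ℝ => perturbedMap f p.2 p.1 :=
  hf.comp (continuous_fst.add ((AddCircle.continuous_mk' 1).comp continuous_snd))

/-- The chain is strong Feller. In the coordinate `s` of `ℝ`, the number `2ε P(s, B)` is the
integral over `[s - ε, s + ε]` of the indicator of the preimage of `B`. -/
lemma continuous_transitionProb {f : UnitAddCircle → UnitAddCircle} (hf : Continuous f) {ε : ℝ}
    (hε : 0 < ε) {B : Set UnitAddCircle} (hB : MeasurableSet B) :
    Continuous fun x => transitionProb f ε x B := by
  rw [(QuotientAddGroup.isQuotientMap_mk (AddSubgroup.zmultiples (1 : ℝ))).continuous_iff]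
  set D : Set ℝ := {t : ℝ | f (t : UnitAddCircle) ∈ B} with hD
  have hDm : MeasurableSet D := (hf.comp (AddCircle.continuous_mk' 1)).measurable hB
  have hint : ∀ a b : ℝ, IntervalIntegrable (D.indicator (1 : ℝ → ℝ)) volume a b := by
    intro a b
    rw [intervalIntegrable_iff]
    exact (intervalIntegrable_iff.1 (intervalIntegrable_const (c := (1 : ℝ)))).indicator hDm
  have key : ∀ s : ℝ, transitionProb f ε (s : UnitAddCircle) B
      = (volume (Set.Icc (-ε) ε))⁻¹ * ENNReal.ofReal
        ((∫ t in (0 : ℝ)..(s + ε), D.indicator (1 : ℝ → ℝ) t)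
          - ∫ t in (0 : ℝ)..(s - ε), D.indicator (1 : ℝ → ℝ) t) := by
    intro s
    rw [intervalIntegral.integral_interval_sub_left (hint _ _) (hint _ _),
      intervalIntegral.integral_of_le (by linarith), ← integral_Icc_eq_integral_Ioc,
      integral_indicator_one hDm, measureReal_restrict_apply hDm, measureReal_def,
      ENNReal.ofReal_toReal]
    · rw [transitionProb, uniformNoise, cond_apply measurableSet_Icc,
        ← measure_preimage_add volume s (D ∩ Set.Icc (s - ε) (s + ε))]
      congr 2
      ext ω
      simp only [perturbedMap, Set.mem_inter_iff, Set.mem_Icc, Set.mem_preimage, hD,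
        Set.mem_ofPred_eq, AddCircle.coe_add]
      constructor
      · rintro ⟨⟨h1, h2⟩, h3⟩
        exact ⟨h3, by linarith, by linarith⟩
      · rintro ⟨h3, h1, h2⟩
        exact ⟨⟨by linarith, by linarith⟩, h3⟩
    · exact ((measure_mono Set.inter_subset_right).trans_lt measure_Icc_lt_top).ne
  have hprim := intervalIntegral.continuous_primitive hint 0
  have : Continuous fun s : ℝ => (volume (Set.Icc (-ε) ε))⁻¹ * ENNReal.ofReal
        ((∫ t in (0 : ℝ)..(s + ε), D.indicator (1 : ℝ → ℝ) t)
          - ∫ t in (0 : ℝ)..(s - ε), D.indicator (1 : ℝ → ℝ) t) := by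
    refine (ENNReal.continuous_const_mul ?_).comp (ENNReal.continuous_ofReal.comp ?_)
    · refine ENNReal.inv_ne_top.2 ?_
      rw [Real.volume_Icc]
      simpa using hε
    · exact (hprim.comp (continuous_add_const ε)).sub (hprim.comp (continuous_id.sub continuous_const))
  exact this.congr fun s => (key s).symm

lemma transitionProb_mono (f : UnitAddCircle → UnitAddCircle) (ε : ℝ) (x : UnitAddCircle)
    {A B : Set UnitAddCircle} (h : A ⊆ B) : transitionProb f ε x A ≤ transitionProb f ε x B :=
  measure_mono fun _ hω => h hω

lemma transitionProb_add_compl {f : UnitAddCircle → UnitAddCircle} (hf : Continuous f) {ε : ℝ}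
    (hε : 0 < ε) (x : UnitAddCircle) {A : Set UnitAddCircle} (hA : MeasurableSet A) :
    transitionProb f ε x A + transitionProb f ε x Aᶜ = 1 := by
  have := isProbabilityMeasure_uniformNoise hε
  have h : MeasurableSet {ω : ℝ | perturbedMap f ω x ∈ A} :=
    (continuous_perturbedMap hf x).measurable hA
  exact prob_add_prob_compl h

/-! ### Stationary measures when closed invariant sets are trivial -/

/-- The topological irreducibility of the chain: a nonempty closed set which the random maps
`f_ω`, `|ω| < ε`, send into itself is the whole circle. -/
def NoiseMinimal (f : UnitAddCircle → UnitAddCircle) (ε : ℝ) : Prop :=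
  ∀ S : Set UnitAddCircle, IsClosed S → S.Nonempty →
    (∀ x ∈ S, ∀ ω : ℝ, |ω| < ε → perturbedMap f ω x ∈ S) → S = Set.univ

/-- The support of a nonzero stationary measure is closed and invariant under the random maps. -/
lemma support_eq_univ_of_stationary {f : UnitAddCircle → UnitAddCircle} (hf : Continuous f)
    {ε : ℝ} (hε : 0 < ε) (hmin : NoiseMinimal f ε) {τ : Measure UnitAddCircle} (hτ : τ ≠ 0)
    (hst : ∀ B, MeasurableSet B → τ B = ∫⁻ x, transitionProb f ε x B ∂τ) :
    τ.support = Set.univ := by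
  have hopen : IsOpen τ.supportᶜ := Measure.isOpen_compl_support
  have hcont := continuous_transitionProb hf hε hopen.measurableSet
  have hae : ∀ᵐ x ∂τ, transitionProb f ε x τ.supportᶜ = 0 := by
    have h0 : ∫⁻ x, transitionProb f ε x τ.supportᶜ ∂τ = 0 := by
      rw [← hst _ hopen.measurableSet, Measure.measure_compl_support]
    exact (lintegral_eq_zero_iff hcont.measurable).1 h0
  refine hmin _ Measure.isClosed_support (Measure.nonempty_support hτ) fun x hx ω hω => ?_
  have hPx : transitionProb f ε x τ.supportᶜ = 0 := by
    by_contra hne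
    have hU : IsOpen {y | transitionProb f ε y τ.supportᶜ ≠ 0} :=
      isOpen_ne.preimage hcont
    exact ((Measure.mem_support_iff_forall x).1 hx _ (hU.mem_nhds hne)).ne' hae
  by_contra hmem
  have hV : IsOpen (Set.Ioo (-ε) ε ∩ {ω : ℝ | perturbedMap f ω x ∈ τ.supportᶜ}) :=
    isOpen_Ioo.inter (hopen.preimage (continuous_perturbedMap hf x))
  have hpos : 0 < volume (Set.Ioo (-ε) ε ∩ {ω : ℝ | perturbedMap f ω x ∈ τ.supportᶜ}) :=
    hV.measure_pos volume ⟨ω, abs_lt.1 hω, hmem⟩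
  rw [transitionProb, uniformNoise, cond_apply measurableSet_Icc, mul_eq_zero] at hPx
  rcases hPx with h | h
  · simp [Real.volume_Icc] at h
  · exact hpos.ne' (measure_mono_null
      (Set.inter_subset_inter_left _ Set.Ioo_subset_Icc_self) h)

/-- By the strong Feller property, an almost sure statement about `P(x, A)` that is closed holds
for every `x`. -/
lemma forall_of_ae_of_stationary {f : UnitAddCircle → UnitAddCircle} (hf : Continuous f)
    {ε : ℝ} (hε : 0 < ε) (hmin : NoiseMinimal f ε) {τ : Measure UnitAddCircle} (hτ : τ ≠ 0)
    (hst : ∀ B, MeasurableSet B → τ B = ∫⁻ x, transitionProb f ε x B ∂τ)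
    {A : Set UnitAddCircle} (hA : MeasurableSet A) {Z : Set ENNReal} (hZ : IsClosed Z)
    (h : ∀ᵐ x ∂τ, transitionProb f ε x A ∈ Z) (x : UnitAddCircle) :
    transitionProb f ε x A ∈ Z := by
  have hcl : IsClosed {x | transitionProb f ε x A ∈ Z} :=
    hZ.preimage (continuous_transitionProb hf hε hA)
  have := Measure.support_subset_of_isClosed hcl h
  rw [support_eq_univ_of_stationary hf hε hmin hτ hst] at this
  exact this (Set.mem_univ x)

/-- If `P(x, A)` takes only the values `0` and `1` almost surely, then it does so everywhere and
is constant because the circle is connected. -/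
lemma zero_or_one_of_stationary {f : UnitAddCircle → UnitAddCircle} (hf : Continuous f)
    {ε : ℝ} (hε : 0 < ε) (hmin : NoiseMinimal f ε) {μ : Measure UnitAddCircle}
    (hμ : IsStationaryMeasure f ε μ) {A : Set UnitAddCircle} (hA : MeasurableSet A)
    (h : ∀ᵐ x ∂μ, transitionProb f ε x A = A.indicator (fun _ => (1 : ENNReal)) x) :
    μ A = 0 ∨ μ A = 1 := by
  have := hμ.isProbabilityMeasure
  have hcont := continuous_transitionProb hf hε hA
  have h01 : ∀ x, transitionProb f ε x A ∈ ({0, 1} : Set ENNReal) := by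
    refine forall_of_ae_of_stationary hf hε hmin (IsProbabilityMeasure.ne_zero μ) hμ.stationary hA
      (Set.toFinite _).isClosed ?_
    filter_upwards [h] with x hx
    rw [hx]
    by_cases hxA : x ∈ A <;> simp [hxA]
  have hconst : ∀ x, transitionProb f ε x A = transitionProb f ε 0 A := fun x =>
    isPreconnected_univ.constant_of_mapsTo (Set.toFinite ({0, 1} : Set ENNReal)).isDiscrete
      hcont.continuousOn (fun x _ => h01 x) (Set.mem_univ x) (Set.mem_univ 0)
  have hμA : μ A = transitionProb f ε 0 A := by
    rw [hμ.stationary A hA, lintegral_congr hconst]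
    simp
  rw [hμA]
  exact h01 0

lemma sub_restrict_compl (μ ν : Measure UnitAddCircle) {A : Set UnitAddCircle}
    (hA : MeasurableSet A) : (μ.restrict A - ν.restrict A) Aᶜ = 0 := by
  refine le_antisymm ?_ zero_le
  calc (μ.restrict A - ν.restrict A) Aᶜ ≤ μ.restrict A Aᶜ := Measure.le_iff'.1 Measure.sub_le _
    _ = 0 := by rw [Measure.restrict_apply hA.compl]; simp

/-- The excess of `μ` over `ν` on the part `A` of the space where it is the larger one is
subinvariant, hence stationary because the total mass is preserved. -/
lemma stationary_sub_restrict {f : UnitAddCircle → UnitAddCircle} (hf : Continuous f)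
    {ε : ℝ} (hε : 0 < ε) {μ ν : Measure UnitAddCircle}
    (hμ : IsStationaryMeasure f ε μ) (hν : IsStationaryMeasure f ε ν) {A : Set UnitAddCircle}
    (hA : IsHahnDecomposition ν μ A) {B : Set UnitAddCircle} (hB : MeasurableSet B) :
    (μ.restrict A - ν.restrict A) B
      = ∫⁻ x, transitionProb f ε x B ∂(μ.restrict A - ν.restrict A) := by
  have := hμ.isProbabilityMeasure
  have := hν.isProbabilityMeasure
  have hAm := hA.measurableSet
  set τ := μ.restrict A - ν.restrict A with hτ
  have hadd : τ + ν.restrict A = μ.restrict A := Measure.sub_add_cancel_of_le hA.le_on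
  have hτle : τ ≤ μ := Measure.sub_le.trans Measure.restrict_le_self
  have : IsFiniteMeasure τ := isFiniteMeasure_of_le μ hτle
  have hle : μ ≤ τ + ν := by
    calc μ = μ.restrict A + μ.restrict Aᶜ := (Measure.restrict_add_restrict_compl hAm).symm
      _ ≤ (τ + ν.restrict A) + ν.restrict Aᶜ := by
        rw [hadd]; exact add_le_add le_rfl hA.ge_on_compl
      _ = τ + ν := by rw [add_assoc, Measure.restrict_add_restrict_compl hAm]
  have hτA : τ Aᶜ = 0 := sub_restrict_compl μ ν hAm
  have hsub : ∀ B, MeasurableSet B → τ B ≤ ∫⁻ x, transitionProb f ε x B ∂τ := by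
    intro B hB
    have h1 : τ B = τ (B ∩ A) := (measure_inter_conull hτA).symm
    have h2 : τ (B ∩ A) + ν (B ∩ A) = μ (B ∩ A) := by
      have := congrArg (fun m : Measure UnitAddCircle => m (B ∩ A)) hadd
      simpa [Measure.restrict_apply (hB.inter hAm), Set.inter_assoc] using this
    have h3 : μ (B ∩ A) ≤ ∫⁻ x, transitionProb f ε x (B ∩ A) ∂τ + ν (B ∩ A) := by
      rw [hμ.stationary _ (hB.inter hAm), hν.stationary _ (hB.inter hAm),
        ← lintegral_add_measure]
      exact lintegral_mono' hle le_rfl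
    rw [← h2] at h3
    rw [h1]
    exact (ENNReal.le_of_add_le_add_right (measure_ne_top ν _) h3).trans
      (lintegral_mono fun x => transitionProb_mono f ε x Set.inter_subset_left)
  refine le_antisymm (hsub B hB) ?_
  have htot : ∫⁻ x, transitionProb f ε x B ∂τ + ∫⁻ x, transitionProb f ε x Bᶜ ∂τ
      = τ B + τ Bᶜ := by
    rw [← lintegral_add_left (continuous_transitionProb hf hε hB).measurable,
      measure_add_measure_compl hB,
      lintegral_congr fun x => transitionProb_add_compl hf hε x hB]
    simp
  have h4 := hsub Bᶜ hB.compl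
  have h5 : ∫⁻ x, transitionProb f ε x B ∂τ + τ Bᶜ ≤ τ B + τ Bᶜ := by
    rw [← htot]; gcongr
  exact ENNReal.le_of_add_le_add_right (measure_ne_top τ _) h5

/-- For distinct stationary measures, the excess of each over the other is stationary and nonzero,
and the two excesses live on a set `A` and on its complement. Then `P(x, Aᶜ)` and `P(x, A)` both
vanish for every `x`, although their sum is `1`. -/
lemma stationary_unique {f : UnitAddCircle → UnitAddCircle} (hf : Continuous f)
    {ε : ℝ} (hε : 0 < ε) (hmin : NoiseMinimal f ε) {μ ν : Measure UnitAddCircle}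
    (hμ : IsStationaryMeasure f ε μ) (hν : IsStationaryMeasure f ε ν) : μ = ν := by
  have := hμ.isProbabilityMeasure
  have := hν.isProbabilityMeasure
  obtain ⟨A, hA⟩ := exists_isHahnDecomposition ν μ
  have hAm := hA.measurableSet
  have hA' : IsHahnDecomposition μ ν Aᶜ := hA.compl
  -- a nonzero excess measure on `A` forces `P(x, Aᶜ) = 0` for all `x`
  have hnull : ∀ {μ ν : Measure UnitAddCircle}, IsStationaryMeasure f ε μ →
      IsStationaryMeasure f ε ν → ∀ {A : Set UnitAddCircle}, IsHahnDecomposition ν μ A →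
      μ.restrict A - ν.restrict A ≠ 0 → transitionProb f ε 0 Aᶜ = 0 := by
    intro μ ν hμ hν A hA hne
    have hst := fun B (hB : MeasurableSet B) => stationary_sub_restrict hf hε hμ hν hA hB
    have hAm := hA.measurableSet.compl
    refine forall_of_ae_of_stationary hf hε hmin hne hst hAm (isClosed_singleton (x := 0)) ?_ 0
    have h0 := hst Aᶜ hAm
    rw [sub_restrict_compl μ ν hA.measurableSet] at h0
    exact (lintegral_eq_zero_iff (continuous_transitionProb hf hε hAm).measurable).1 h0.symm
  by_cases h1 : μ.restrict A - ν.restrict A = 0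
  · have hle : μ ≤ ν := by
      have h : μ.restrict A ≤ ν.restrict A := by
        have := Measure.sub_add_cancel_of_le hA.le_on
        rw [h1, zero_add] at this
        exact this.ge
      rw [← Measure.restrict_add_restrict_compl (μ := μ) hAm,
        ← Measure.restrict_add_restrict_compl (μ := ν) hAm]
      exact add_le_add h hA.ge_on_compl
    exact Measure.eq_of_le_of_isProbabilityMeasure hle
  by_cases h2 : ν.restrict Aᶜ - μ.restrict Aᶜ = 0
  · have hle : ν ≤ μ := by
      have h : ν.restrict Aᶜ ≤ μ.restrict Aᶜ := by
        have := Measure.sub_add_cancel_of_le hA'.le_on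
        rw [h2, zero_add] at this
        exact this.ge
      rw [← Measure.restrict_add_restrict_compl (μ := μ) hAm,
        ← Measure.restrict_add_restrict_compl (μ := ν) hAm]
      exact add_le_add hA.le_on h
    exact (Measure.eq_of_le_of_isProbabilityMeasure hle).symm
  have e1 := hnull hμ hν hA h1
  have e2 := hnull hν hμ hA' h2
  rw [compl_compl] at e2
  have := transitionProb_add_compl hf hε 0 hAm
  rw [e1, e2] at this
  simp at this

/-! ### Existence of a stationary measure -/

/-- The law of `f_ω(x)` when `x` has law `μ` and `ω` is independent noise. -/
noncomputable def noiseStep (f : UnitAddCircle → UnitAddCircle) (ε : ℝ)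
    (μ : Measure UnitAddCircle) : Measure UnitAddCircle :=
  (μ.prod (uniformNoise ε)).map fun p => perturbedMap f p.2 p.1

lemma isProbabilityMeasure_noiseStep {f : UnitAddCircle → UnitAddCircle} (hf : Continuous f)
    {ε : ℝ} (hε : 0 < ε) (μ : Measure UnitAddCircle) [IsProbabilityMeasure μ] :
    IsProbabilityMeasure (noiseStep f ε μ) := by
  have := isProbabilityMeasure_uniformNoise hε
  exact Measure.isProbabilityMeasure_map (continuous_perturbedMap_uncurry hf).aemeasurable

lemma noiseStep_apply {f : UnitAddCircle → UnitAddCircle} (hf : Continuous f)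
    {ε : ℝ} (hε : 0 < ε) (μ : Measure UnitAddCircle) {B : Set UnitAddCircle}
    (hB : MeasurableSet B) : noiseStep f ε μ B = ∫⁻ x, transitionProb f ε x B ∂μ := by
  have := isProbabilityMeasure_uniformNoise hε
  have hm := (continuous_perturbedMap_uncurry hf).measurable
  rw [noiseStep, Measure.map_apply hm hB, Measure.prod_apply (hm hB)]
  rfl

lemma integral_noiseStep {f : UnitAddCircle → UnitAddCircle} (hf : Continuous f)
    {ε : ℝ} (hε : 0 < ε) (μ : Measure UnitAddCircle) [IsProbabilityMeasure μ]
    {g : UnitAddCircle → ℝ} (hg : Continuous g) :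
    ∫ x, g x ∂noiseStep f ε μ = ∫ x, ∫ ω, g (perturbedMap f ω x) ∂uniformNoise ε ∂μ := by
  have := isProbabilityMeasure_uniformNoise hε
  have hc := continuous_perturbedMap_uncurry hf
  obtain ⟨C, hC⟩ := isCompact_univ.exists_bound_of_continuousOn hg.continuousOn
  rw [noiseStep, integral_map hc.aemeasurable hg.aestronglyMeasurable, integral_prod]
  exact Integrable.of_bound (hg.comp hc).aestronglyMeasurable C
    (Filter.Eventually.of_forall fun p => hC _ (Set.mem_univ _))

lemma continuous_integral_perturbedMap {f : UnitAddCircle → UnitAddCircle} (hf : Continuous f)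
    {ε : ℝ} (hε : 0 < ε) {g : UnitAddCircle → ℝ} (hg : Continuous g) :
    Continuous fun x => ∫ ω, g (perturbedMap f ω x) ∂uniformNoise ε := by
  have := isProbabilityMeasure_uniformNoise hε
  obtain ⟨C, hC⟩ := isCompact_univ.exists_bound_of_continuousOn hg.continuousOn
  refine continuous_of_dominated (bound := fun _ => C) (fun x => ?_) (fun x => ?_)
    (integrable_const C) ?_
  · exact (hg.comp (continuous_perturbedMap hf x)).aestronglyMeasurable
  · exact Filter.Eventually.of_forall fun ω => hC _ (Set.mem_univ _)
  · exact Filter.Eventually.of_forall fun ω =>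
      hg.comp ((continuous_perturbedMap_uncurry hf).comp (continuous_id.prodMk continuous_const))

/-- Krylov–Bogoliubov: a limit point of the time averages of the laws of the chain is
stationary, because the chain is Feller. -/
lemma exists_stationary {f : UnitAddCircle → UnitAddCircle} (hf : Continuous f)
    {ε : ℝ} (hε : 0 < ε) : ∃ μ, IsStationaryMeasure f ε μ := by
  set law : ℕ → Measure UnitAddCircle := fun i => (noiseStep f ε)^[i] (Measure.dirac 0)
    with hlaw
  have hlaw_succ : ∀ i, law (i + 1) = noiseStep f ε (law i) := fun i =>
    Function.iterate_succ_apply' _ _ _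
  have hlaw_prob : ∀ i, IsProbabilityMeasure (law i) := by
    intro i
    induction i with
    | zero => simpa [hlaw] using (inferInstance : IsProbabilityMeasure (Measure.dirac _))
    | succ i ih => rw [hlaw_succ]; exact isProbabilityMeasure_noiseStep hf hε _
  set avg : ℕ → Measure UnitAddCircle := fun n =>
    ((n : ENNReal) + 1)⁻¹ • ∑ i ∈ Finset.range (n + 1), law i with havg
  have hne : ∀ n : ℕ, (n : ENNReal) + 1 ≠ 0 := fun n => by simp
  have havg_prob : ∀ n, IsProbabilityMeasure (avg n) := by
    intro n
    constructor
    simp only [havg, Measure.smul_apply, Measure.finsetSum_apply, measure_univ, smul_eq_mul]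
    simpa using ENNReal.inv_mul_cancel (hne n) (by simp)
  have hint : ∀ (i : ℕ) {g : UnitAddCircle → ℝ}, Continuous g → Integrable g (law i) := by
    intro i g hg
    obtain ⟨C, hC⟩ := isCompact_univ.exists_bound_of_continuousOn hg.continuousOn
    exact Integrable.of_bound hg.aestronglyMeasurable C
      (Filter.Eventually.of_forall fun p => hC _ (Set.mem_univ _))
  have havg_int : ∀ (n : ℕ) {g : UnitAddCircle → ℝ}, Continuous g →
      ∫ x, g x ∂avg n = ((n : ℝ) + 1)⁻¹ * ∑ i ∈ Finset.range (n + 1), ∫ x, g x ∂law i := by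
    intro n g hg
    rw [havg, integral_smul_measure, integral_finsetSum_measure fun i _ => hint i hg]
    rw [ENNReal.toReal_inv, ENNReal.toReal_add (by simp) (by simp)]
    simp
  set PM : ℕ → ProbabilityMeasure UnitAddCircle := fun n => ⟨avg n, havg_prob n⟩ with hPM
  obtain ⟨μ, hμ⟩ : ∃ μ, Filter.Tendsto PM (Filter.hyperfilter ℕ : Filter ℕ) (nhds μ) :=
    ⟨_, ((Filter.hyperfilter ℕ).map PM).le_nhds_lim⟩
  rw [ProbabilityMeasure.tendsto_iff_forall_integral_tendsto] at hμ
  have hlim : ∀ {g : UnitAddCircle → ℝ}, Continuous g → Filter.Tendsto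
      (fun n => ∫ x, g x ∂avg n) (Filter.hyperfilter ℕ : Filter ℕ)
      (nhds (∫ x, g x ∂(μ : Measure UnitAddCircle))) := fun {g} hg =>
    hμ (BoundedContinuousFunction.mkOfCompact ⟨g, hg⟩)
  have := isProbabilityMeasure_noiseStep hf hε (μ : Measure UnitAddCircle)
  have hfix : noiseStep f ε (μ : Measure UnitAddCircle) = μ := by
    refine ext_of_forall_integral_eq_of_IsFiniteMeasure fun g => ?_
    have hg := g.continuous
    rw [integral_noiseStep hf hε _ hg]
    have h1 := (hlim (continuous_integral_perturbedMap hf hε hg)).sub (hlim hg)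
    -- the sums telescope, leaving two boundary terms divided by `n + 1`
    have h2 : ∀ n : ℕ, ∫ x, (∫ ω, g (perturbedMap f ω x) ∂uniformNoise ε) ∂avg n
        - ∫ x, g x ∂avg n
        = ((n : ℝ) + 1)⁻¹ * (∫ x, g x ∂law (n + 1) - ∫ x, g x ∂law 0) := by
      intro n
      rw [havg_int n hg, havg_int n (continuous_integral_perturbedMap hf hε hg), ← mul_sub,
        ← Finset.sum_sub_distrib, ← Finset.sum_range_sub (fun i => ∫ x, g x ∂law i)]
      congr 1
      refine Finset.sum_congr rfl fun i _ => ?_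
      rw [hlaw_succ, integral_noiseStep hf hε _ hg]
    have h3 : Filter.Tendsto (fun n : ℕ =>
        ((n : ℝ) + 1)⁻¹ * (∫ x, g x ∂law (n + 1) - ∫ x, g x ∂law 0)) Filter.atTop (nhds 0) := by
      refine Filter.Tendsto.zero_mul_isBoundedUnder_le ?_ ?_
      · exact (Filter.tendsto_atTop_add_const_right _ _ tendsto_natCast_atTop_atTop).inv_tendsto_atTop
      · refine Filter.isBoundedUnder_of ⟨‖g‖ + ‖g‖, fun n => ?_⟩
        refine (norm_sub_le _ _).trans (add_le_add ?_ ?_) <;>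
        · refine (norm_integral_le_of_norm_le_const
            (Filter.Eventually.of_forall fun x => g.norm_coe_le_norm x)).trans ?_
          simp
    have h4 := h3.mono_left Nat.hyperfilter_le_atTop
    simp only [h2] at h1
    exact sub_eq_zero.1 (tendsto_nhds_unique h1 h4)
  refine ⟨μ, inferInstance, fun B hB => ?_⟩
  rw [← noiseStep_apply hf hε _ hB, hfix]

/-- A chain all of whose closed invariant sets are trivial has a unique stationary measure, which
is ergodic and has full support. -/
theorem exists_unique_stationary_of_noiseMinimal {f : UnitAddCircle → UnitAddCircle}
    (hf : Continuous f) {ε : ℝ} (hε : 0 < ε) (hmin : NoiseMinimal f ε) :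
    ∃ μ : Measure UnitAddCircle, IsStationaryMeasure f ε μ ∧
      (∀ μ' : Measure UnitAddCircle, IsStationaryMeasure f ε μ' → μ' = μ) ∧
      IsErgodicStationary f ε μ ∧ μ.support = Set.univ := by
  obtain ⟨μ, hμ⟩ := exists_stationary hf hε
  have := hμ.isProbabilityMeasure
  exact ⟨μ, hμ, fun μ' hμ' => stationary_unique hf hε hmin hμ' hμ,
    ⟨hμ, fun A hA h => zero_or_one_of_stationary hf hε hmin hμ hA h⟩,
    support_eq_univ_of_stationary hf hε hmin (IsProbabilityMeasure.ne_zero μ) hμ.stationary⟩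

/-! ### The function `ψ` in the coordinate of `ℝ` -/

/-- Quantitative nondegeneracy of the critical points of `Ψ : ℝ → ℝ`: the derivative is bounded by
`K₁` and bounded below by `κ` times the distance to the critical set, the increments from critical
points are at most `K₂` times the square of the distance, and distinct critical points are at
least `s` apart. -/
structure CriticalBounds (Ψ : ℝ → ℝ) (K₁ K₂ κ s : ℝ) : Prop where
  differentiable : Differentiable ℝ Ψ
  isClosed : IsClosed {t | deriv Ψ t = 0}
  nonempty : {t | deriv Ψ t = 0}.Nonempty
  abs_deriv_le : ∀ t, |deriv Ψ t| ≤ K₁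
  abs_sub_le_sq : ∀ z, deriv Ψ z = 0 → ∀ t, |Ψ t - Ψ z| ≤ K₂ * |t - z| ^ 2
  le_abs_deriv : ∀ t, κ * Metric.infDist t {t | deriv Ψ t = 0} ≤ |deriv Ψ t|
  separated : ∀ z z', deriv Ψ z = 0 → deriv Ψ z' = 0 → z ≠ z' → s ≤ |z - z'|

lemma exists_bound_of_periodic {g : ℝ → ℝ} (hg : Continuous g) (hper : Function.Periodic g 1) :
    ∃ K : ℝ, 0 < K ∧ ∀ t, |g t| ≤ K := by
  obtain ⟨K, hK⟩ := (isCompact_Icc (a := (0 : ℝ)) (b := 1)).exists_bound_of_continuousOn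
    hg.continuousOn
  refine ⟨max K 1, by positivity, fun t => ?_⟩
  obtain ⟨y, hy, hty⟩ := hper.exists_mem_Ico₀ one_pos t
  rw [hty]
  exact (hK y (Set.Ico_subset_Icc_self hy)).trans (le_max_left _ _)

lemma periodic_deriv {g : ℝ → ℝ} (hper : Function.Periodic g 1) :
    Function.Periodic (deriv g) 1 := fun t => by
  rw [← deriv_comp_add_const, show (fun x => g (x + 1)) = g from funext hper]

lemma circleDeriv_coe (ψ : UnitAddCircle → ℝ) (t : ℝ) :
    circleDeriv ψ (t : UnitAddCircle) = deriv (fun t : ℝ => ψ (t : UnitAddCircle)) t := by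
  have h := deriv_comp_const_add (fun t : ℝ => ψ (t : UnitAddCircle)) t 0
  rw [add_zero] at h
  rw [circleDeriv, ← h]
  simp only [AddCircle.coe_add]

/-- Near a critical point the bound is the nondegeneracy, elsewhere `Ψ'` does not vanish, and
compactness of a period makes the constant uniform. -/
lemma exists_mul_infDist_le {g : ℝ → ℝ} (hg : Differentiable ℝ g)
    (hper : Function.Periodic g 1) (hne : {t | g t = 0}.Nonempty)
    (hnd : ∀ z, g z = 0 → deriv g z ≠ 0) :
    ∃ κ : ℝ, 0 < κ ∧ ∀ t, κ * Metric.infDist t {t | g t = 0} ≤ |g t| := by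
  set C : Set ℝ := {t | g t = 0} with hC
  have hloc : ∀ t : ℝ, ∃ κ : ℝ, 0 < κ ∧ ∀ᶠ u in nhds t, κ * Metric.infDist u C ≤ |g u| := by
    intro t
    by_cases ht : g t = 0
    · have hd := (hg t).hasDerivAt
      have hpos : 0 < |deriv g t| := abs_pos.2 (hnd t ht)
      refine ⟨|deriv g t| / 2, by positivity, ?_⟩
      have ho := hd.isLittleO.def (half_pos hpos)
      filter_upwards [ho] with u hu
      have h1 : Metric.infDist u C ≤ |u - t| := Metric.infDist_le_dist_of_mem ht
      rw [ht, sub_zero, smul_eq_mul, Real.norm_eq_abs, Real.norm_eq_abs] at hu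
      have h2 : |(u - t) * deriv g t| ≤ |g u - (u - t) * deriv g t| + |g u| := by
        have := abs_sub (g u) (g u - (u - t) * deriv g t)
        rw [sub_sub_cancel] at this
        linarith
      rw [abs_mul] at h2
      nlinarith [abs_nonneg (u - t)]
    · have hpos : 0 < |g t| := abs_pos.2 ht
      have hi : 0 ≤ Metric.infDist t C := Metric.infDist_nonneg
      refine ⟨|g t| / (2 * (Metric.infDist t C + 1)), by positivity, ?_⟩
      have h1 : ∀ᶠ u in nhds t, |g t| / 2 < |g u| :=
        ((hg.continuous.abs).tendsto t).eventually (lt_mem_nhds (half_lt_self hpos))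
      have h2 : ∀ᶠ u in nhds t, Metric.infDist u C < Metric.infDist t C + 1 :=
        ((Metric.continuous_infDist_pt C).tendsto t).eventually (gt_mem_nhds (by linarith))
      filter_upwards [h1, h2] with u hu1 hu2
      refine le_trans ?_ hu1.le
      rw [div_mul_eq_mul_div, div_le_div_iff₀ (by positivity) (by positivity)]
      nlinarith
  have hcomp : ∃ κ : ℝ, 0 < κ ∧ ∀ t ∈ Set.Icc (0 : ℝ) 1, κ * Metric.infDist t C ≤ |g t| := by
    refine (isCompact_Icc (a := (0 : ℝ)) (b := 1)).induction_on
      (p := fun s => ∃ κ : ℝ, 0 < κ ∧ ∀ t ∈ s, κ * Metric.infDist t C ≤ |g t|) ?_ ?_ ?_ ?_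
    · exact ⟨1, one_pos, by simp⟩
    · rintro s t hst ⟨κ, h0, h⟩
      exact ⟨κ, h0, fun u hu => h u (hst hu)⟩
    · rintro s t ⟨κ, h0, h⟩ ⟨κ', h0', h'⟩
      refine ⟨min κ κ', lt_min h0 h0', ?_⟩
      rintro u (hu | hu)
      · exact (mul_le_mul_of_nonneg_right (min_le_left _ _) Metric.infDist_nonneg).trans (h u hu)
      · exact (mul_le_mul_of_nonneg_right (min_le_right _ _) Metric.infDist_nonneg).trans (h' u hu)
    · intro t _
      obtain ⟨κ, h0, h⟩ := hloc t
      exact ⟨_, mem_nhdsWithin_of_mem_nhds h, κ, h0, fun u hu => hu⟩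
  obtain ⟨κ, h0, h⟩ := hcomp
  refine ⟨κ, h0, fun t => ?_⟩
  have hinv : Metric.infDist t C ≤ Metric.infDist (Int.fract t) C := by
    rw [Metric.le_infDist hne]
    intro z hz
    have hz' : z + ⌊t⌋ ∈ C := by
      have := hper.int_mul ⌊t⌋ z
      rw [mul_one] at this
      simpa [hC, this] using hz
    refine (Metric.infDist_le_dist_of_mem hz').trans (le_of_eq ?_)
    rw [Real.dist_eq, Real.dist_eq, Int.fract]
    congr 1
    ring
  have hgf : g (Int.fract t) = g t := by
    have := hper.sub_int_mul_eq (x := t) ⌊t⌋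
    rwa [mul_one] at this
  have := h (Int.fract t) ⟨Int.fract_nonneg t, (Int.fract_lt_one t).le⟩
  rw [hgf] at this
  exact (mul_le_mul_of_nonneg_left hinv h0.le).trans this

lemma mem_critSet_coe {ψ : UnitAddCircle → ℝ} {t : ℝ} :
    (t : UnitAddCircle) ∈ critSet ψ ↔ deriv (fun t : ℝ => ψ (t : UnitAddCircle)) t = 0 := by
  rw [critSet, Set.mem_ofPred_eq, circleDeriv_coe]

theorem IsAdmissible.exists_criticalBounds {ψ : UnitAddCircle → ℝ} (hψ : IsAdmissible ψ) :
    ∃ K₁ K₂ κ s : ℝ, 0 < K₁ ∧ 0 < K₂ ∧ 0 < κ ∧ 0 < s ∧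
      CriticalBounds (fun t : ℝ => ψ (t : UnitAddCircle)) K₁ K₂ κ s := by
  set Ψ : ℝ → ℝ := fun t => ψ (t : UnitAddCircle) with hΨ
  have hC2 : ContDiff ℝ 2 Ψ := hψ.isC2
  have hper : Function.Periodic Ψ 1 := fun t => by simp [hΨ]
  have hC1 : ContDiff ℝ 1 (deriv Ψ) := by
    have : ContDiff ℝ (1 + 1) Ψ := by simpa [one_add_one_eq_two] using hC2
    exact (contDiff_succ_iff_deriv.1 this).2.2
  have hdiff : Differentiable ℝ Ψ := hC2.differentiable (by norm_num)
  have hdiff' : Differentiable ℝ (deriv Ψ) := hC1.differentiable (by norm_num)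
  have hper' := periodic_deriv hper
  obtain ⟨K₁, hK₁, hb₁⟩ := exists_bound_of_periodic hC1.continuous hper'
  obtain ⟨K₂, hK₂, hb₂⟩ :=
    exists_bound_of_periodic (hC1.continuous_deriv le_rfl) (periodic_deriv hper')
  have hne : {t | deriv Ψ t = 0}.Nonempty := by
    obtain ⟨t, -, ht⟩ := exists_deriv_eq_zero (f := Ψ) zero_lt_one hdiff.continuous.continuousOn
      (by simpa using (hper 0).symm)
    exact ⟨t, ht⟩
  have hnd : ∀ z, deriv Ψ z = 0 → deriv (deriv Ψ) z ≠ 0 := by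
    intro z hz hz2
    have hmem : (z : UnitAddCircle) ∈ {x | circleDeriv (circleDeriv ψ) x = 0} ∩ critSet ψ := by
      refine ⟨?_, mem_critSet_coe.2 hz⟩
      rw [Set.mem_ofPred_eq, circleDeriv_coe]
      simpa only [circleDeriv_coe] using hz2
    rw [hψ.nondegenerate] at hmem
    exact hmem
  obtain ⟨κ, hκ, hbκ⟩ := exists_mul_infDist_le hdiff' hper' hne hnd
  obtain ⟨r, hr, hsep⟩ : ∃ r : ℝ, 0 < r ∧ ∀ x ∈ critSet ψ, ∀ y ∈ critSet ψ, x ≠ y →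
      r ≤ dist x y := by
    by_cases hnt : (critSet ψ).Nontrivial
    · exact ⟨_, (hψ.finite_critSet.infsep_pos_iff_nontrivial).2 hnt,
        fun x hx y hy hxy => Set.infsep_le_dist_of_mem hx hy hxy⟩
    · refine ⟨1, one_pos, fun x hx y hy hxy => ?_⟩
      exact absurd (Set.not_nontrivial_iff.1 hnt hx hy) hxy
  refine ⟨K₁, K₂, κ, min r 1, hK₁, hK₂, hκ, lt_min hr one_pos, hdiff, ?_, hne, hb₁, ?_, hbκ, ?_⟩
  · exact isClosed_singleton.preimage hC1.continuous
  · intro z hz t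
    have h1 : ∀ u, |deriv Ψ u| ≤ K₂ * |u - z| := by
      intro u
      have := convex_univ.norm_image_sub_le_of_norm_deriv_le (f := deriv Ψ) (C := K₂)
        (fun x _ => hdiff' x) (fun x _ => hb₂ x) (Set.mem_univ z) (Set.mem_univ u)
      rwa [hz, sub_zero] at this
    have h2 := (convex_uIcc z t).norm_image_sub_le_of_norm_deriv_le (f := Ψ) (C := K₂ * |t - z|)
      (fun x _ => hdiff x) (fun x hx => (h1 x).trans
        (mul_le_mul_of_nonneg_left (Set.abs_sub_left_of_mem_uIcc hx) hK₂.le))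
      Set.left_mem_uIcc Set.right_mem_uIcc
    rw [Real.norm_eq_abs, Real.norm_eq_abs] at h2
    linarith
  · intro z z' hz hz' hzz
    by_cases h : (z : UnitAddCircle) = (z' : UnitAddCircle)
    · -- two lifts of one critical point differ by a nonzero integer
      rw [← sub_eq_zero, ← AddCircle.coe_sub, AddCircle.coe_eq_zero_iff] at h
      obtain ⟨n, hn⟩ := h
      rw [zsmul_one] at hn
      have hn0 : n ≠ 0 := by
        rintro rfl
        exact hzz (sub_eq_zero.1 (by simpa using hn.symm))
      rw [← hn]
      exact (min_le_right _ _).trans (by exact_mod_cast Int.one_le_abs hn0)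
    · refine (min_le_left _ _).trans ((hsep _ (mem_critSet_coe.2 hz) _ (mem_critSet_coe.2 hz')
        h).trans ?_)
      rw [dist_eq_norm, ← AddCircle.coe_sub]
      exact QuotientAddGroup.norm_mk_le_norm

/-! ### Expansion of intervals -/

/-- The lift `t ↦ L Ψ(t) + a` of the circle map. -/
def liftMap (Ψ : ℝ → ℝ) (L a t : ℝ) : ℝ := L * Ψ t + a

/-- The set `T` contains an interval of length `ℓ`. -/
def ContainsInterval (T : Set ℝ) (ℓ : ℝ) : Prop := ∃ u, Set.Icc u (u + ℓ) ⊆ T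

/-- `L` is large in terms of the constants of `Ψ` and of the separation `c`. An interval that stays
within `c / 2` of a point at distance `c` from the critical set is expanded by at least
`L * (κ * c / 2)`. -/
structure LargeParameter (K₁ K₂ κ s c L : ℝ) : Prop where
  K₁_pos : 0 < K₁
  K₂_pos : 0 < K₂
  κ_pos : 0 < κ
  s_pos : 0 < s
  c_pos : 0 < c
  L_pos : 0 < L
  K₁_le : K₁ ≤ L * (κ * c / 2) ^ 2
  K₂_le : 2048 * K₂ ≤ L * κ ^ 2 * c
  le_mul_sq : 32 ≤ L * κ * min (s / 4) (c / 2) ^ 2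

lemma ContainsInterval.mono {T : Set ℝ} {ℓ ℓ' : ℝ} (h : ContainsInterval T ℓ) (hle : ℓ' ≤ ℓ) :
    ContainsInterval T ℓ' := by
  obtain ⟨u, hu⟩ := h
  exact ⟨u, (Set.Icc_subset_Icc_right (by linarith)).trans hu⟩

lemma ContainsInterval.of_uIcc {T : Set ℝ} {p q ℓ : ℝ} (h : Set.uIcc p q ⊆ T)
    (hle : ℓ ≤ |p - q|) : ContainsInterval T ℓ := by
  refine ContainsInterval.mono ⟨min p q, ?_⟩ hle
  rwa [← max_sub_min_eq_abs', add_sub_cancel]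

lemma doubling_induction {P : ℝ → Prop} (hmono : ∀ x y, P x → y ≤ x → P y) {ℓ₀ c₁ : ℝ}
    (h0 : 0 < ℓ₀) (hP : P ℓ₀) (hstep : ∀ ℓ, ℓ₀ ≤ ℓ → ℓ ≤ c₁ → P ℓ → P (2 * ℓ)) : P c₁ := by
  have key : ∀ n : ℕ, P (min c₁ (2 ^ n * ℓ₀)) := by
    intro n
    induction n with
    | zero => exact hmono _ _ hP (by simp)
    | succ n ih =>
      rcases le_total (2 ^ n * ℓ₀) c₁ with h | h
      · rw [min_eq_right h] at ih
        refine hmono _ _ (hstep _ ?_ h ih) ((min_le_right _ _).trans (by rw [pow_succ']; linarith))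
        exact le_mul_of_one_le_left h0.le (one_le_pow₀ one_le_two)
      · rw [min_eq_left h] at ih
        exact hmono _ _ ih (min_le_left _ _)
  obtain ⟨n, hn⟩ := pow_unbounded_of_one_lt (c₁ / ℓ₀) one_lt_two
  have := key n
  rwa [min_eq_left ((div_le_iff₀ h0).1 hn.le)] at this

section

variable {Ψ : ℝ → ℝ} {K₁ K₂ κ s c L a : ℝ}

lemma CriticalBounds.continuous_liftMap (h : CriticalBounds Ψ K₁ K₂ κ s) :
    Continuous (liftMap Ψ L a) :=
  (continuous_const.mul h.differentiable.continuous).add continuous_const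

lemma abs_liftMap_sub (hL : 0 < L) (p q : ℝ) :
    |liftMap Ψ L a p - liftMap Ψ L a q| = L * |Ψ p - Ψ q| := by
  rw [liftMap, liftMap, add_sub_add_right_eq_sub, ← mul_sub, abs_mul, abs_of_pos hL]

lemma CriticalBounds.abs_liftMap_sub_le (h : CriticalBounds Ψ K₁ K₂ κ s) (hL : 0 < L)
    (p q : ℝ) : |liftMap Ψ L a p - liftMap Ψ L a q| ≤ L * K₁ * |p - q| := by
  rw [abs_liftMap_sub hL, mul_assoc]
  exact mul_le_mul_of_nonneg_left (convex_univ.norm_image_sub_le_of_norm_deriv_le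
    (fun x _ => h.differentiable x) (fun x _ => h.abs_deriv_le x) (Set.mem_univ q)
    (Set.mem_univ p)) hL.le

lemma CriticalBounds.le_abs_liftMap_sub (h : CriticalBounds Ψ K₁ K₂ κ s) (hL : 0 < L)
    {r p q : ℝ} (hr : ∀ t ∈ Set.uIcc p q, r ≤ |deriv Ψ t|) :
    L * r * |p - q| ≤ |liftMap Ψ L a p - liftMap Ψ L a q| := by
  rw [abs_liftMap_sub hL, mul_assoc]
  refine mul_le_mul_of_nonneg_left ?_ hL.le
  wlog hpq : p ≤ q generalizing p q
  · rw [abs_sub_comm p, abs_sub_comm (Ψ p)]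
    exact this (by rwa [Set.uIcc_comm]) (le_of_not_ge hpq)
  rcases hpq.eq_or_lt with rfl | hlt
  · simp
  obtain ⟨t, ht, hder⟩ := exists_deriv_eq_slope Ψ hlt h.differentiable.continuous.continuousOn
    h.differentiable.differentiableOn
  have hpos : 0 < q - p := sub_pos.2 hlt
  have h1 := hr t (by rw [Set.uIcc_of_le hpq]; exact Set.Ioo_subset_Icc_self ht)
  rw [hder, abs_div, abs_of_pos hpos, le_div_iff₀ hpos] at h1
  rwa [abs_sub_comm p, abs_sub_comm (Ψ p), abs_of_pos hpos]

lemma uIcc_image_subset (h : CriticalBounds Ψ K₁ K₂ κ s) {T : Set ℝ} {p q : ℝ}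
    (hT : ∀ t ∈ T, liftMap Ψ L a t ∈ T) (hpq : Set.uIcc p q ⊆ T) :
    Set.uIcc (liftMap Ψ L a p) (liftMap Ψ L a q) ⊆ T := by
  refine (intermediate_value_uIcc h.continuous_liftMap.continuousOn).trans ?_
  rintro _ ⟨t, ht, rfl⟩
  exact hT t (hpq ht)

/-- Of a short interval, the first or the last quarter stays away from the critical set: the
interval is near one critical point only. The number `d` is the distance of the end `p` of
that quarter to the critical set, and `z` is a critical point nearest to `p`. -/
lemma CriticalBounds.exists_quarter (h : CriticalBounds Ψ K₁ K₂ κ s) {u ℓ : ℝ} (hℓ : 0 < ℓ)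
    (hs : ℓ ≤ s / 4) :
    ∃ p z d : ℝ, Set.uIcc p (p + ℓ / 4) ⊆ Set.Icc u (u + ℓ) ∧ deriv Ψ z = 0 ∧ ℓ / 4 ≤ d ∧
      ∀ t ∈ Set.uIcc p (p + ℓ / 4),
        d / 2 ≤ Metric.infDist t {t | deriv Ψ t = 0} ∧ |t - z| ≤ 2 * d := by
  set C : Set ℝ := {t | deriv Ψ t = 0} with hC
  obtain ⟨p, hp, hfar⟩ : ∃ p, Set.Icc p (p + ℓ / 4) ⊆ Set.Icc u (u + ℓ) ∧
      ∀ t ∈ Set.Icc p (p + ℓ / 4), ℓ / 4 ≤ Metric.infDist t C := by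
    by_contra! hcon
    obtain ⟨t₁, ht₁, hd₁⟩ := hcon u (Set.Icc_subset_Icc_right (by linarith))
    obtain ⟨t₂, ht₂, hd₂⟩ := hcon (u + 3 * ℓ / 4)
      (Set.Icc_subset_Icc (by linarith) (by linarith))
    obtain ⟨z₁, hz₁, hdz₁⟩ := (Metric.infDist_lt_iff h.nonempty).1 hd₁
    obtain ⟨z₂, hz₂, hdz₂⟩ := (Metric.infDist_lt_iff h.nonempty).1 hd₂
    rw [Real.dist_eq, abs_lt] at hdz₁ hdz₂
    have hlt : z₁ < z₂ := by linarith [hdz₁.1, hdz₂.2, ht₁.2, ht₂.1]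
    have := h.separated z₂ z₁ hz₂ hz₁ hlt.ne'
    rw [abs_of_pos (sub_pos.2 hlt)] at this
    linarith [hdz₁.2, hdz₂.1, ht₁.1, ht₂.2]
  obtain ⟨z, hz, hzd⟩ := h.isClosed.exists_infDist_eq_dist h.nonempty p
  have hle : p ≤ p + ℓ / 4 := by linarith
  have hd := hfar p (Set.left_mem_Icc.2 hle)
  refine ⟨p, z, Metric.infDist p C, by rwa [Set.uIcc_of_le hle], hz, hd, fun t ht => ?_⟩
  rw [Set.uIcc_of_le hle] at ht
  have htp : |t - p| ≤ ℓ / 4 := by rw [abs_le]; constructor <;> linarith [ht.1, ht.2]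
  constructor
  · have h1 : Metric.infDist p C ≤ Metric.infDist t C + dist p t :=
      Metric.infDist_le_infDist_add_dist
    rw [dist_comm, Real.dist_eq] at h1
    linarith [hfar t ht]
  · have h2 := abs_sub_le t p z
    rw [Real.dist_eq] at hzd
    linarith

/-- An interval whose points stay within `c / 2` of the orbit of `w` for `m` steps, while that
orbit is at distance `c` from the critical set, is expanded exponentially. -/
lemma CriticalBounds.expand_along_orbit (h : CriticalBounds Ψ K₁ K₂ κ s)
    (hLp : LargeParameter K₁ K₂ κ s c L) {k : ℕ} {w : ℝ}
    (hw : ∀ l < k, c ≤ Metric.infDist ((liftMap Ψ L a)^[l] w) {t | deriv Ψ t = 0})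
    {T : Set ℝ} (hT : ∀ t ∈ T, liftMap Ψ L a t ∈ T) {p q A : ℝ} (hp : |p - w| ≤ A)
    (hq : |q - w| ≤ A) (hpq : Set.uIcc p q ⊆ T) (m : ℕ) (hmk : m ≤ k)
    (hA : ∀ j < m, (L * K₁) ^ j * A ≤ c / 2) :
    Set.uIcc ((liftMap Ψ L a)^[m] p) ((liftMap Ψ L a)^[m] q) ⊆ T ∧
      (L * (κ * c / 2)) ^ m * |p - q| ≤ |(liftMap Ψ L a)^[m] p - (liftMap Ψ L a)^[m] q| ∧
      |(liftMap Ψ L a)^[m] p - (liftMap Ψ L a)^[m] w| ≤ (L * K₁) ^ m * A ∧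
      |(liftMap Ψ L a)^[m] q - (liftMap Ψ L a)^[m] w| ≤ (L * K₁) ^ m * A := by
  have hL := hLp.L_pos
  have hκ := hLp.κ_pos
  have hc := hLp.c_pos
  have hK₁ := hLp.K₁_pos
  induction m with
  | zero => simpa using ⟨hpq, hp, hq⟩
  | succ m ih =>
    obtain ⟨h1, h2, h3, h4⟩ := ih (by omega) fun j hj => hA j (by omega)
    have hAm := hA m (by omega)
    have hwm := hw m (by omega)
    simp only [Function.iterate_succ_apply']
    set P := (liftMap Ψ L a)^[m] p
    set Q := (liftMap Ψ L a)^[m] q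
    set W := (liftMap Ψ L a)^[m] w
    have hder : ∀ t ∈ Set.uIcc P Q, κ * c / 2 ≤ |deriv Ψ t| := by
      intro t ht
      have htW : |t - W| ≤ c / 2 := by
        rw [abs_le] at h3 h4 ⊢
        rcases Set.mem_uIcc.1 ht with ht | ht <;> constructor <;> linarith [ht.1, ht.2]
      have h5 : Metric.infDist W {t | deriv Ψ t = 0}
          ≤ Metric.infDist t {t | deriv Ψ t = 0} + dist W t := Metric.infDist_le_infDist_add_dist
      rw [dist_comm, Real.dist_eq] at h5
      have h6 := mul_le_mul_of_nonneg_left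
        (show c / 2 ≤ Metric.infDist t {t | deriv Ψ t = 0} by linarith) hκ.le
      linarith [h.le_abs_deriv t]
    refine ⟨uIcc_image_subset h hT h1, ?_, ?_, ?_⟩
    · refine le_trans ?_ (h.le_abs_liftMap_sub hL hder)
      rw [pow_succ', mul_assoc]
      exact mul_le_mul_of_nonneg_left h2 (by positivity)
    · refine (h.abs_liftMap_sub_le hL _ _).trans ?_
      rw [pow_succ', mul_assoc (L * K₁)]
      exact mul_le_mul_of_nonneg_left h3 (by positivity)
    · refine (h.abs_liftMap_sub_le hL _ _).trans ?_
      rw [pow_succ', mul_assoc (L * K₁)]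
      exact mul_le_mul_of_nonneg_left h4 (by positivity)

/-- A short interval in an invariant set either produces one of twice its length, or its image
comes extremely close to a critical value. If the image leaves the `c / 2`-neighbourhood of the
critical orbit at a time `m < k`, then `d` is, up to constants, at least `L ^ (-(m + 1) / 2)`, so
that the expansion during `m` steps outweighs the contraction at the critical point. -/
lemma CriticalBounds.double_or_close (h : CriticalBounds Ψ K₁ K₂ κ s)
    (hLp : LargeParameter K₁ K₂ κ s c L) {k : ℕ}
    (hsep : ∀ z, deriv Ψ z = 0 → ∀ l < k,
      c ≤ Metric.infDist ((liftMap Ψ L a)^[l] (liftMap Ψ L a z)) {t | deriv Ψ t = 0})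
    {T : Set ℝ} (hT : ∀ t ∈ T, liftMap Ψ L a t ∈ T) {ℓ : ℝ} (hℓ : 0 < ℓ) (hs : ℓ ≤ s / 4)
    (hTℓ : ContainsInterval T ℓ) :
    ContainsInterval T (2 * ℓ) ∨ ∃ z p d : ℝ, deriv Ψ z = 0 ∧ p ∈ T ∧ ℓ / 4 ≤ d ∧
      |liftMap Ψ L a p - liftMap Ψ L a z| ≤ 4 * L * K₂ * d ^ 2 ∧
      (L * (κ * c / 2)) ^ k * (L * κ * d / 8) < 2 := by
  have hL := hLp.L_pos
  have hκ := hLp.κ_pos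
  have hc := hLp.c_pos
  have hK₁ := hLp.K₁_pos
  have hK₂ := hLp.K₂_pos
  obtain ⟨u, hu⟩ := hTℓ
  obtain ⟨p, z, d, hpq, hz, hd, hfar⟩ := h.exists_quarter (u := u) hℓ hs
  set q := p + ℓ / 4 with hq
  have hd0 : 0 < d := by linarith
  have hpqT := hpq.trans hu
  have hpqabs : |p - q| = ℓ / 4 := by rw [hq, abs_sub_comm, add_sub_cancel_left,
    abs_of_pos (by linarith)]
  have himg := uIcc_image_subset (L := L) (a := a) h hT hpqT
  have hlen : L * κ * d / 8 * ℓ ≤ |liftMap Ψ L a p - liftMap Ψ L a q| := by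
    have := h.le_abs_liftMap_sub (a := a) hL (r := κ * (d / 2)) (p := p) (q := q) fun t ht =>
      (mul_le_mul_of_nonneg_left (hfar t ht).1 hκ.le).trans (h.le_abs_deriv t)
    rw [hpqabs] at this
    linarith
  have hclose : ∀ t ∈ Set.uIcc p q,
      |liftMap Ψ L a t - liftMap Ψ L a z| ≤ 4 * L * K₂ * d ^ 2 := by
    intro t ht
    rw [abs_liftMap_sub hL]
    have h1 := h.abs_sub_le_sq z hz t
    have h2 : |t - z| ^ 2 ≤ (2 * d) ^ 2 := pow_le_pow_left₀ (abs_nonneg _) (hfar t ht).2 2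
    calc L * |Ψ t - Ψ z| ≤ L * (K₂ * (2 * d) ^ 2) := by gcongr; exact h1.trans (by gcongr)
      _ = 4 * L * K₂ * d ^ 2 := by ring
  have hcp := hclose p Set.left_mem_uIcc
  have hcq := hclose q Set.right_mem_uIcc
  have hdouble : ∀ m ≤ k, (∀ j < m, (L * K₁) ^ j * (4 * L * K₂ * d ^ 2) ≤ c / 2) →
      2 ≤ (L * (κ * c / 2)) ^ m * (L * κ * d / 8) → ContainsInterval T (2 * ℓ) := by
    intro m hmk hA hg
    obtain ⟨h1, h2, -, -⟩ :=
      h.expand_along_orbit hLp (hsep z hz) hT hcp hcq himg m hmk hA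
    refine ContainsInterval.of_uIcc h1 (le_trans ?_ h2)
    calc 2 * ℓ ≤ (L * (κ * c / 2)) ^ m * (L * κ * d / 8) * ℓ := by gcongr
      _ = (L * (κ * c / 2)) ^ m * (L * κ * d / 8 * ℓ) := by ring
      _ ≤ _ := by gcongr
  by_cases hexit : ∃ j, j < k ∧ c / 2 < (L * K₁) ^ j * (4 * L * K₂ * d ^ 2)
  · left
    classical
    obtain ⟨hmk, hmA⟩ := Nat.find_spec hexit
    refine hdouble (Nat.find hexit) hmk.le (fun j hj => ?_) ?_
    · by_contra! hcon
      exact Nat.find_min hexit hj ⟨hj.trans hmk, hcon⟩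
    set m := Nat.find hexit
    have hpow : (L * K₁) ^ m ≤ ((L * (κ * c / 2)) ^ m) ^ 2 := by
      rw [← pow_mul, mul_comm m, pow_mul]
      refine pow_le_pow_left₀ (by positivity) ?_ m
      calc L * K₁ ≤ L * (L * (κ * c / 2) ^ 2) := by gcongr; exact hLp.K₁_le
        _ = _ := by ring
    set X := (L * (κ * c / 2)) ^ m
    -- the square of the gain is at least `L κ² c / (512 K₂)`
    have hsq : 2 ^ 2 ≤ (X * (L * κ * d / 8)) ^ 2 := by
      have e1 : (X * (L * κ * d / 8)) ^ 2
          = L * κ ^ 2 / (256 * K₂) * (X ^ 2 * (4 * L * K₂ * d ^ 2)) := by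
        field_simp
        ring
      have e2 : L * κ ^ 2 / (256 * K₂) * (c / 2)
          ≤ L * κ ^ 2 / (256 * K₂) * (X ^ 2 * (4 * L * K₂ * d ^ 2)) := by
        gcongr
        exact hmA.le.trans (by gcongr)
      have e3 : 2 ^ 2 ≤ L * κ ^ 2 / (256 * K₂) * (c / 2) := by
        rw [div_mul_div_comm, le_div_iff₀ (by positivity)]
        linarith [hLp.K₂_le]
      rw [e1]
      exact e3.trans e2
    exact le_of_sq_le_sq hsq (by positivity)
  · push Not at hexit
    rcases le_or_gt 2 ((L * (κ * c / 2)) ^ k * (L * κ * d / 8)) with hg | hg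
    · exact Or.inl (hdouble k le_rfl hexit hg)
    · exact Or.inr ⟨z, p, d, hz, hpqT Set.left_mem_uIcc, hd, hcp, hg⟩

/-- An interval of length `ε / 2` ending at a critical value grows along the critical orbit, until
it is longer than `c / 2` or the `k` steps are over. -/
lemma CriticalBounds.grow_from_critical_value (h : CriticalBounds Ψ K₁ K₂ κ s)
    (hLp : LargeParameter K₁ K₂ κ s c L) {k : ℕ} {w ε : ℝ} (hε : 0 < ε)
    (hw : ∀ l < k, c ≤ Metric.infDist ((liftMap Ψ L a)^[l] w) {t | deriv Ψ t = 0})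
    {T : Set ℝ} (hT : ∀ t ∈ T, liftMap Ψ L a t ∈ T) (hwT : Set.Icc w (w + ε / 2) ⊆ T) :
    ContainsInterval T (min (c / 2) (ε / 2 * (L * (κ * c / 2)) ^ k)) := by
  have hL := hLp.L_pos
  have hκ := hLp.κ_pos
  have hc := hLp.c_pos
  set v := w + ε / 2 with hv
  have key : ∀ m ≤ k, ContainsInterval T (c / 2) ∨
      (Set.uIcc ((liftMap Ψ L a)^[m] w) ((liftMap Ψ L a)^[m] v) ⊆ T ∧
        ε / 2 * (L * (κ * c / 2)) ^ m ≤ |(liftMap Ψ L a)^[m] w - (liftMap Ψ L a)^[m] v|) := by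
    intro m
    induction m with
    | zero =>
      intro _
      refine Or.inr ⟨?_, ?_⟩
      · simpa [Set.uIcc_of_le (show w ≤ v by linarith)] using hwT
      · simp [hv, le_abs_self]
    | succ m ih =>
      intro hmk
      rcases ih (by omega) with hdone | ⟨h1, h2⟩
      · exact Or.inl hdone
      simp only [Function.iterate_succ_apply']
      have hwm := hw m (by omega)
      set W := (liftMap Ψ L a)^[m] w
      set V := (liftMap Ψ L a)^[m] v
      rcases le_or_gt (c / 2) |W - V| with hlong | hshort
      · exact Or.inl (ContainsInterval.of_uIcc h1 hlong)
      refine Or.inr ⟨uIcc_image_subset h hT h1, ?_⟩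
      have hder : ∀ t ∈ Set.uIcc W V, κ * c / 2 ≤ |deriv Ψ t| := by
        intro t ht
        have htW := Set.abs_sub_left_of_mem_uIcc ht
        rw [abs_sub_comm V] at htW
        have h5 : Metric.infDist W {t | deriv Ψ t = 0}
            ≤ Metric.infDist t {t | deriv Ψ t = 0} + dist W t :=
          Metric.infDist_le_infDist_add_dist
        rw [dist_comm, Real.dist_eq] at h5
        have h6 := mul_le_mul_of_nonneg_left
          (show c / 2 ≤ Metric.infDist t {t | deriv Ψ t = 0} by linarith) hκ.le
        linarith [h.le_abs_deriv t]
      refine le_trans ?_ (h.le_abs_liftMap_sub hL hder)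
      rw [pow_succ', mul_left_comm]
      exact mul_le_mul_of_nonneg_left h2 (by positivity)
  rcases key k le_rfl with hdone | ⟨h1, h2⟩
  · exact hdone.mono (min_le_left _ _)
  · exact (ContainsInterval.of_uIcc h1 h2).mono (min_le_right _ _)

/-- A set invariant under the lift with noise of size `ε` contains an interval whose image has
length at least one. The intervals double in length until they have length `c₁`. If the doubling
fails, the noise provides an interval of length `ε / 2` ending at a critical value, which grows to
length `ε / 2 * X`; from this length on the doubling does not fail again, by `hε₂`. -/
theorem CriticalBounds.exists_long_image (h : CriticalBounds Ψ K₁ K₂ κ s)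
    (hLp : LargeParameter K₁ K₂ κ s c L) {k : ℕ} {ε : ℝ} (hε : 0 < ε)
    (hsep : ∀ z, deriv Ψ z = 0 → ∀ l < k,
      c ≤ Metric.infDist ((liftMap Ψ L a)^[l] (liftMap Ψ L a z)) {t | deriv Ψ t = 0})
    (hε₁ : 4096 * K₂ ≤ ε * L * ((L * (κ * c / 2)) ^ k) ^ 2 * κ ^ 2)
    (hε₂ : 128 ≤ ε * L * ((L * (κ * c / 2)) ^ k) ^ 2 * κ)
    {T : Set ℝ} (hT : ∀ t ∈ T, ∀ y, |y - liftMap Ψ L a t| < ε → y ∈ T)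
    (hTε : ContainsInterval T ε) :
    ∃ p q, Set.uIcc p q ⊆ T ∧ 1 ≤ |liftMap Ψ L a p - liftMap Ψ L a q| := by
  have hL := hLp.L_pos
  have hκ := hLp.κ_pos
  have hc := hLp.c_pos
  have hK₂ := hLp.K₂_pos
  have hT' : ∀ t ∈ T, liftMap Ψ L a t ∈ T := fun t ht => hT t ht _ (by simpa using hε)
  set X := (L * (κ * c / 2)) ^ k with hX
  have hX0 : 0 < X := by positivity
  set c₁ := min (s / 4) (c / 2) with hc₁
  have hc₁0 : 0 < c₁ := lt_min (by linarith [hLp.s_pos]) (by linarith)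
  -- intervals of length `ε / 2 * X` never come too close to a critical value
  have hlong : ContainsInterval T (min c₁ (ε / 2 * X)) → ContainsInterval T c₁ := by
    intro h0
    rcases le_total c₁ (ε / 2 * X) with hle | hle
    · rwa [min_eq_left hle] at h0
    rw [min_eq_right hle] at h0
    refine doubling_induction (fun _ _ hx hy => hx.mono hy) (by positivity) h0 ?_
    intro ℓ hℓ0 hℓ1 hℓT
    have hℓpos : 0 < ℓ := lt_of_lt_of_le (by positivity) hℓ0
    refine (h.double_or_close hLp hsep hT' hℓpos (hℓ1.trans (min_le_left _ _)) hℓT).resolve_right ?_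
    rintro ⟨z, p, d, -, -, hd, -, hlt⟩
    have : X * (L * κ * (ε / 2 * X / 4) / 8) ≤ X * (L * κ * d / 8) := by
      gcongr
      linarith
    have e : X * (L * κ * (ε / 2 * X / 4) / 8) = ε * L * X ^ 2 * κ / 64 := by ring
    linarith
  have hc₁T : ContainsInterval T c₁ := by
    by_contra hcon
    refine hcon (doubling_induction (fun _ _ hx hy => hx.mono hy) hε hTε ?_)
    intro ℓ hℓ0 hℓ1 hℓT
    have hℓpos : 0 < ℓ := hε.trans_le hℓ0
    refine (h.double_or_close hLp hsep hT' hℓpos (hℓ1.trans (min_le_left _ _)) hℓT).resolve_right ?_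
    rintro ⟨z, p, d, hz, hp, hd, hpz, hlt⟩
    refine hcon (hlong ?_)
    have hd0 : 0 < d := by linarith
    -- the image is so close to the critical value that the noise reaches it
    have hnear : 4 * L * K₂ * d ^ 2 ≤ ε / 4 := by
      have h1 : (X * (L * κ * d / 8)) ^ 2 ≤ 2 ^ 2 :=
        pow_le_pow_left₀ (by positivity) hlt.le 2
      have h2 : (L * X ^ 2 * κ ^ 2) * (16 * L * K₂ * d ^ 2) ≤ (L * X ^ 2 * κ ^ 2) * ε := by
        calc (L * X ^ 2 * κ ^ 2) * (16 * L * K₂ * d ^ 2)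
            = 1024 * K₂ * (X * (L * κ * d / 8)) ^ 2 := by ring
          _ ≤ 1024 * K₂ * 2 ^ 2 := by gcongr
          _ ≤ (L * X ^ 2 * κ ^ 2) * ε := by linarith
      have := le_of_mul_le_mul_left h2 (by positivity)
      linarith
    refine (h.grow_from_critical_value hLp hε (hsep z hz) hT' fun y hy => ?_).mono
      (min_le_min_right _ (min_le_right _ _))
    refine hT p hp y ?_
    have := abs_le.1 (hpz.trans hnear)
    rw [abs_lt]
    constructor <;> linarith [hy.1, hy.2, this.1, this.2]
  obtain ⟨u, hu⟩ := hc₁T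
  obtain ⟨p, z, d, hpq, -, hd, hfar⟩ := h.exists_quarter (u := u) hc₁0 (min_le_left _ _)
  refine ⟨p, _, hpq.trans hu, ?_⟩
  have hlen := h.le_abs_liftMap_sub (a := a) hL (r := κ * (d / 2)) (p := p) (q := p + c₁ / 4)
    fun t ht => (mul_le_mul_of_nonneg_left (hfar t ht).1 hκ.le).trans (h.le_abs_deriv t)
  refine le_trans ?_ hlen
  rw [abs_sub_comm, add_sub_cancel_left, abs_of_pos (by linarith)]
  calc 1 ≤ L * κ * c₁ ^ 2 / 32 := by linarith [hLp.le_mul_sq]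
    _ = L * (κ * (c₁ / 4 / 2)) * (c₁ / 4) := by ring
    _ ≤ L * (κ * (d / 2)) * (c₁ / 4) := by gcongr

end

/-! ### From the lift to the circle -/

lemma familyMap_iterate_coe (ψ : UnitAddCircle → ℝ) (L a : ℝ) (l : ℕ) (t : ℝ) :
    (familyMap ψ L a)^[l] (t : UnitAddCircle)
      = ((liftMap (fun t : ℝ => ψ (t : UnitAddCircle)) L a)^[l] t : ℝ) := by
  induction l with
  | zero => rfl
  | succ l ih => rw [Function.iterate_succ_apply', Function.iterate_succ_apply', ih]; rfl

lemma IsAdmissible.continuous_familyMap {ψ : UnitAddCircle → ℝ} (hψ : IsAdmissible ψ)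
    (L a : ℝ) : Continuous (familyMap ψ L a) := by
  have hcont : Continuous ψ :=
    (QuotientAddGroup.isQuotientMap_mk (AddSubgroup.zmultiples (1 : ℝ))).continuous_iff.2
      hψ.isC2.continuous
  exact (AddCircle.continuous_mk' 1).comp ((continuous_const.mul hcont).add continuous_const)

lemma PostcriticalSeparation.le_infDist {ψ : UnitAddCircle → ℝ} {L a c : ℝ} {k : ℕ}
    (h : PostcriticalSeparation ψ L a c k) (z : ℝ)
    (hz : deriv (fun t : ℝ => ψ (t : UnitAddCircle)) z = 0) (l : ℕ) (hl : l < k) :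
    c ≤ Metric.infDist ((liftMap (fun t : ℝ => ψ (t : UnitAddCircle)) L a)^[l]
      (liftMap (fun t : ℝ => ψ (t : UnitAddCircle)) L a z))
      {t | deriv (fun t : ℝ => ψ (t : UnitAddCircle)) t = 0} := by
  have h1 := h z (mem_critSet_coe.2 hz) (l + 1) (by omega) hl
  rw [familyMap_iterate_coe, Function.iterate_succ_apply] at h1
  refine (Metric.le_infDist ⟨z, hz⟩).2 fun z' hz' => (h1.trans
    (Metric.infDist_le_dist_of_mem (mem_critSet_coe.2 hz'))).trans ?_
  rw [dist_eq_norm, ← AddCircle.coe_sub]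
  exact QuotientAddGroup.norm_mk_le_norm

/-- The bound `ε ≥ L ^ (-(2 k + 1) (1 - β))`, in the form in which it is used: `L ^ β` absorbs the
factor `r⁻²` lost in each of the `k` steps. -/
lemma rpow_le_mul_of_noise_bound {L β ε r : ℝ} {k : ℕ} (hL : 0 < L) (hr : 0 < r)
    (hLr : 1 ≤ L ^ β * r) (hε : L ^ (-(2 * (k : ℝ) + 1) * (1 - β)) ≤ ε) :
    L ^ β ≤ ε * L * ((L * r) ^ k) ^ 2 := by
  have hLβ : 0 < L ^ β := Real.rpow_pos_of_pos hL β
  have hid : L ^ (-(2 * (k : ℝ) + 1) * (1 - β)) * L ^ (2 * k + 1) = (L ^ β) ^ (2 * k + 1) := by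
    rw [← Real.rpow_natCast L, ← Real.rpow_add hL, ← Real.rpow_natCast (L ^ β),
      ← Real.rpow_mul hL.le]
    congr 1
    push_cast
    ring
  calc L ^ β ≤ L ^ β * (L ^ β * r) ^ (2 * k) :=
        le_mul_of_one_le_right hLβ.le (one_le_pow₀ hLr)
    _ = (L ^ β) ^ (2 * k + 1) * r ^ (2 * k) := by rw [mul_pow]; ring
    _ = L ^ (-(2 * (k : ℝ) + 1) * (1 - β)) * L ^ (2 * k + 1) * r ^ (2 * k) := by rw [hid]
    _ ≤ ε * L ^ (2 * k + 1) * r ^ (2 * k) := by gcongr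
    _ = ε * L * ((L * r) ^ k) ^ 2 := by rw [mul_pow]; ring

/-- A closed invariant set `S` of the chain lifts to a noise-invariant subset of the line; the
long image found there covers the circle. -/
lemma CriticalBounds.noiseMinimal {ψ : UnitAddCircle → ℝ} {K₁ K₂ κ s c L a ε : ℝ} {k : ℕ}
    (h : CriticalBounds (fun t : ℝ => ψ (t : UnitAddCircle)) K₁ K₂ κ s)
    (hLp : LargeParameter K₁ K₂ κ s c L) (hε : 0 < ε) (hsep : PostcriticalSeparation ψ L a c k)
    (hε₁ : 4096 * K₂ ≤ ε * L * ((L * (κ * c / 2)) ^ k) ^ 2 * κ ^ 2)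
    (hε₂ : 128 ≤ ε * L * ((L * (κ * c / 2)) ^ k) ^ 2 * κ) :
    NoiseMinimal (familyMap ψ L a) ε := by
  rintro S - ⟨x, hx⟩ hS
  set F := liftMap (fun t : ℝ => ψ (t : UnitAddCircle)) L a with hF
  -- the points of `S` displaced by the noise
  set T : Set ℝ := {t | ∃ y : ℝ, (y : UnitAddCircle) ∈ S ∧ |t - y| < ε} with hT
  have hFT : ∀ t ∈ T, ((F t : ℝ) : UnitAddCircle) ∈ S := by
    rintro t ⟨y, hy, hty⟩
    have := hS _ hy _ hty
    rwa [perturbedMap, ← AddCircle.coe_add, add_sub_cancel] at this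
  obtain ⟨x, rfl⟩ := QuotientAddGroup.mk_surjective x
  obtain ⟨p, q, hpq, hlong⟩ := h.exists_long_image (a := a) hLp hε hsep.le_infDist hε₁ hε₂
    (T := T) (fun t ht y hy => ⟨F t, hFT t ht, hy⟩) (by
      refine ⟨x - ε / 2, fun t ht => ⟨x, hx, ?_⟩⟩
      rw [abs_lt]
      constructor <;> linarith [ht.1, ht.2])
  refine Set.eq_univ_of_forall fun y => ?_
  obtain ⟨t, ht, rfl⟩ : ∃ t ∈ Set.uIcc (F p) (F q), (t : UnitAddCircle) = y := by
    refine ⟨AddCircle.equivIco 1 (min (F p) (F q)) y, ?_, AddCircle.coe_equivIco⟩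
    have hmem := (AddCircle.equivIco 1 (min (F p) (F q)) y).2
    refine ⟨hmem.1, hmem.2.le.trans ?_⟩
    rw [← hF, ← max_sub_min_eq_abs'] at hlong
    change _ ≤ max (F p) (F q)
    linarith
  obtain ⟨v, hv, rfl⟩ := intermediate_value_uIcc h.continuous_liftMap.continuousOn ht
  exact hFT v (hpq hv)

theorem theoremA (ψ : UnitAddCircle → ℝ) (hψ : IsAdmissible ψ)
    (β c : ℝ) (hβ : β ∈ Set.Ioo (0 : ℝ) 1) (hc : c ∈ Set.Ioo (0 : ℝ) 1) :
    ∃ L₀ : ℝ, 0 < L₀ ∧ ∀ L : ℝ, L₀ ≤ L → ∀ a ∈ Set.Ico (0 : ℝ) 1, ∀ k : ℕ,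
      PostcriticalSeparation ψ L a c k →
      ∀ ε : ℝ, L ^ (-(2 * (k : ℝ) + 1) * (1 - β)) ≤ ε →
        ∃ μ : MeasureTheory.Measure UnitAddCircle,
          IsStationaryMeasure (familyMap ψ L a) ε μ ∧
          (∀ μ' : MeasureTheory.Measure UnitAddCircle,
            IsStationaryMeasure (familyMap ψ L a) ε μ' → μ' = μ) ∧
          IsErgodicStationary (familyMap ψ L a) ε μ ∧
          μ.support = Set.univ := by
  obtain ⟨K₁, K₂, κ, s, hK₁, hK₂, hκ, hs, hcb⟩ := hψ.exists_criticalBounds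
  have hc0 : 0 < c := hc.1
  have hmin : 0 < min (s / 4) (c / 2) := lt_min (by linarith) (by linarith)
  have hlin : ∀ b r : ℝ, 0 < r → ∀ᶠ L : ℝ in Filter.atTop, b ≤ L * r := fun b r hr =>
    (Filter.tendsto_id.atTop_mul_const hr).eventually_ge_atTop b
  have hpow : ∀ b r : ℝ, 0 < r → ∀ᶠ L : ℝ in Filter.atTop, b ≤ L ^ β * r := fun b r hr =>
    ((tendsto_rpow_atTop hβ.1).atTop_mul_const hr).eventually_ge_atTop b
  obtain ⟨L₀, hL₀⟩ := Filter.eventually_atTop.1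
    ((hlin K₁ ((κ * c / 2) ^ 2) (by positivity)).and
    ((hlin (2048 * K₂) (κ ^ 2 * c) (by positivity)).and
    ((hlin 32 (κ * min (s / 4) (c / 2) ^ 2) (by positivity)).and
    ((hpow 1 (κ * c / 2) (by positivity)).and
    ((hpow (4096 * K₂) (κ ^ 2) (by positivity)).and (hpow 128 κ hκ))))))
  refine ⟨max L₀ 1, by positivity, fun L hL a _ k hsep ε hε => ?_⟩
  obtain ⟨h1, h2, h3, h4, h5, h6⟩ := hL₀ L ((le_max_left _ _).trans hL)
  have hLpos : 0 < L := one_pos.trans_le ((le_max_right _ _).trans hL)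
  have hεpos : 0 < ε := (Real.rpow_pos_of_pos hLpos _).trans_le hε
  have hLp : LargeParameter K₁ K₂ κ s c L :=
    ⟨hK₁, hK₂, hκ, hs, hc0, hLpos, h1, by linarith, by linarith⟩
  have hE := rpow_le_mul_of_noise_bound (r := κ * c / 2) hLpos (by positivity) h4 hε
  exact exists_unique_stationary_of_noiseMinimal (hψ.continuous_familyMap L a) hεpos
    (CriticalBounds.noiseMinimal hcb hLp hεpos hsep (h5.trans (by gcongr)) (h6.trans (by gcongr)))
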